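/- **Setting.** Let $M$ be a proper CAT(0) space with base point $b$, with boundary at infinity $\partial M$ (carrying the cone topology), and let $G$ be a group. Let $A$ be a finitely generated $G$-module, $F=F_X$ the free $G$-module on a finite set $X$, with $\mathbb Z$-basis $Y=GX$, and $\epsilon:F\twoheadrightarrow A$ a $G$-epimorphism. For each $x\in X$ choose a non-empty finite set $h(x)\subseteq M$ (for instance $h(x)=\{b\}$). For an isometric action $\rho\in\mathrm{Hom}(G,\mathrm{Isom}(M))$ put $h^{(\rho)}(c)=\bigcup_{gx\in\mathrm{supp}(c)}\rho(g)h(x)$ for $c\in F$. For a geodesic ray $\gamma$ let $\beta_\gamma(p)=\lim_{t\to\infty}(t-d(p,\gamma(t)))$; the horoballs at $e=\gamma(\infty)\in\partial M$ are the sets $\{\beta_\gamma\ge t\}$, $t\in\mathbb R$. Put $v^{(\rho)}_\gamma(c)=\min\beta_\gamma(h^{(\rho)}(c))$, with $v^{(\rho)}_\gamma(0)=\infty$. For $\varphi\in\mathrm{End}_{\mathbb Z}(F)$ and $e=\gamma(\infty)$ let $\mathrm{gsh}^{(\rho)}_e(\varphi)=\inf_{0\ne c\in F}\bigl(v^{(\rho)}_\gamma(\varphi(c))-v^{(\rho)}_\gamma(c)\bigr)$,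 which depends only on $e$. A *$G$-volley* on $F$ is a $G$-equivariant map $\Phi$ from $F$ to the set of finite subsets of $F$; it *induces* $\mathrm{id}_A$ if $\epsilon(\Phi(c))=\{\epsilon(c)\}$ for all $c$. A *selection* from $\Phi$ is an additive endomorphism $\varphi$ of $F$ with $\varphi(c)\in\Phi(c)$ for all $c$. An additive endomorphism is *$G$-finitary* if it is a selection from some $G$-volley. Define $$\Sigma({}_\rho M;A)=\{e\in\partial M\mid \text{for every horoball } HB \text{ at } e \text{ and every } a\in A \text{ there is } c\in F \text{ with } \epsilon(c)=a,\ h^{(\rho)}(c)\subseteq HB\},$$ $${}^\circ\Sigma({}_\rho M;A)=\{e\in\partial M\mid \text{there is a } G\text{-finitary } \varphi\in\mathrm{End}_{\mathbb Z}(F) \text{ with } \epsilon\varphi=\epsilon \text{ and } \mathrm{gsh}^{(\rho)}_e(\varphi)>0\}.$$ Regard $G$ as discrete, and give $\mathrm{Hom}(G,\mathrm{Isom}(M))$ and its subsets the compact-open topology. For $E\subseteq\partial M$ let $\mathcal R_E$ be the set of all isometric actions of $G$ on $M$ that leave $E$ invariant. **Theorem.** 1. Let $E\subseteq\partial M$ be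 closed and let $\rho\in\mathcal R_E$ satisfy $E\subseteq\Sigma({}_\rho M;A)$. Then there is a neighbourhood $N$ of $\rho$ in $\mathcal R_E$ such that $E\subseteq{}^\circ\Sigma({}_{\rho'}M;A)$ for all $\rho'\in N$. Moreover, $N$ can be chosen so that there are a constant $\nu>0$ and a $G$-volley $\Phi$ on $F$ inducing $\mathrm{id}_A$ such that for all $e\in E$ and $\rho'\in N$ there is a selection $\varphi$ from $\Phi$ with $\mathrm{gsh}^{(\rho')}_e(\varphi)\ge\nu$. 2. The set of all $\rho\in\mathrm{Hom}(G,\mathrm{Isom}(M))$ with ${}^\circ\Sigma({}_\rho M;A)=\partial M$ is open. 3. In the space of all isometric actions $\rho$ of $G$ on $M$ all of whose orbits are discrete subsets of $M$, the set of those $\rho$ that are cocompact and for which $A$ is finitely generated as a module over the stabilizer $G_b=\{g\in G\mid\rho(g)b=b\}$ is open. -/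

import Mathlib

open Set Filter Topology
open scoped NNReal

noncomputable section

namespace HoroLimit

universe u v w z

/-! ### CAT(0) spaces -/

/-- `M` is a CAT(0) space: a geodesic metric space all of whose geodesic triangles are at least as
thin as their comparison triangles in the Euclidean plane. Here `x` is a point on a geodesic
segment from `p` to `q`, `y` is a point on a geodesic segment from `p` to `r`, the points
`p₀ q₀ r₀` are the vertices of a comparison triangle, and `x₀ y₀` are the comparison points. (In a
geodesic space, the points on geodesic segments from `p` to `q` are exactly the points `x` with
`dist p x + dist x q = dist p q`.) -/
structure IsCAT0 (M : Type z) [MetricSpace M] : Prop where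
  geodesic : ∀ p q : M, ∃ γ : ℝ → M, γ 0 = p ∧ γ (dist p q) = q ∧
    ∀ s ∈ Icc (0 : ℝ) (dist p q), ∀ t ∈ Icc (0 : ℝ) (dist p q), dist (γ s) (γ t) = |s - t|
  thin : ∀ (p q r x y : M) (p₀ q₀ r₀ x₀ y₀ : EuclideanSpace ℝ (Fin 2)),
    dist p x + dist x q = dist p q → dist p y + dist y r = dist p r →
    dist p₀ q₀ = dist p q → dist p₀ r₀ = dist p r → dist q₀ r₀ = dist q r →
    dist p₀ x₀ = dist p x → dist x₀ q₀ = dist x q →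
    dist p₀ y₀ = dist p y → dist y₀ r₀ = dist y r →
    dist x y ≤ dist x₀ y₀

/-! ### Geodesic rays and the boundary at infinity -/

section Boundary

variable {M : Type z} [MetricSpace M]

variable (M) in
/-- A geodesic ray, parametrized by arc length on `[0, ∞)`. -/
structure Ray where
  toFun : ℝ≥0 → M
  isometry : Isometry toFun

/-- The topology of uniform convergence on compact sets on geodesic rays. -/
instance : TopologicalSpace (Ray M) :=
  TopologicalSpace.induced (fun γ => (⟨γ.toFun, γ.isometry.continuous⟩ : C(ℝ≥0, M)))
    ContinuousMap.compactOpen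

variable (M) in
/-- Two rays are asymptotic if they stay within a bounded distance of one another. -/
def asymptotic : Setoid (Ray M) where
  r γ γ' := ∃ K : ℝ, ∀ t : ℝ≥0, dist (γ.toFun t) (γ'.toFun t) ≤ K
  iseqv :=
    { refl := fun γ => ⟨0, fun t => by simp⟩
      symm := fun {γ γ'} ⟨K, hK⟩ => ⟨K, fun t => by rw [dist_comm]; exact hK t⟩
      trans := fun {γ γ' γ''} ⟨K, hK⟩ ⟨L, hL⟩ =>
        ⟨K + L, fun t => (dist_triangle _ (γ'.toFun t) _).trans (add_le_add (hK t) (hL t))⟩ }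

variable (M) in
/-- The boundary at infinity `∂M`: asymptote classes of geodesic rays. -/
def Boundary : Type z := Quotient (asymptotic M)

/-- The endpoint `γ(∞) ∈ ∂M` of a ray `γ`. -/
def Ray.endpoint (γ : Ray M) : Boundary M := Quotient.mk (asymptotic M) γ

/-- The cone topology on `∂M` with respect to the base point `b`: the boundary is identified with
the set of rays issuing from `b`, with the topology of uniform convergence on compact sets. (In a
complete CAT(0) space each class contains exactly one ray from `b`, and the topology does not
depend on `b`.) -/
@[reducible] def coneTopology (b : M) : TopologicalSpace (Boundary M) :=
  TopologicalSpace.coinduced (fun γ : {γ : Ray M // γ.toFun 0 = b} => γ.1.endpoint) inferInstance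

/-- An isometry of `M` maps rays to rays. -/
def Ray.map (f : M ≃ᵢ M) (γ : Ray M) : Ray M := ⟨fun t => f (γ.toFun t), f.isometry.comp γ.isometry⟩

/-- The induced action of an isometry of `M` on `∂M`. -/
def Boundary.map (f : M ≃ᵢ M) : Boundary M → Boundary M :=
  Quotient.map (sa := asymptotic M) (sb := asymptotic M) (Ray.map f) (by
    rintro γ γ' ⟨K, hK⟩
    exact ⟨K, fun t => (f.isometry.dist_eq _ _).trans_le (hK t)⟩)

/-- The Busemann function `β_γ(p) = lim_{t → ∞} (t - d(p, γ(t)))`; it tends to `∞` along `γ`. -/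
def busemann (γ : Ray M) (p : M) : ℝ :=
  limUnder atTop (fun t : ℝ≥0 => (t : ℝ) - dist p (γ.toFun t))

/-- The limit that defines the Busemann function exists. -/
theorem tendsto_busemann (γ : Ray M) (p : M) :
    Tendsto (fun t : ℝ≥0 => (t : ℝ) - dist p (γ.toFun t)) atTop (𝓝 (busemann γ p)) := by
  have hd : ∀ s t : ℝ≥0, dist (γ.toFun s) (γ.toFun t) = |(s : ℝ) - t| := fun s t => by
    rw [γ.isometry.dist_eq]; rfl
  apply tendsto_nhds_limUnder
  refine ⟨_, tendsto_atTop_ciSup ?_ ⟨dist p (γ.toFun 0), ?_⟩⟩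
  · intro s t hst
    have h1 := dist_triangle p (γ.toFun s) (γ.toFun t)
    have h2 : |(s : ℝ) - t| = t - s := by
      rw [abs_sub_comm, abs_of_nonneg (sub_nonneg.2 (by exact_mod_cast hst))]
    rw [hd, h2] at h1
    simp only
    linarith
  · rintro _ ⟨t, rfl⟩
    have h1 := dist_triangle (γ.toFun 0) p (γ.toFun t)
    have h2 : |((0 : ℝ≥0) : ℝ) - t| = t := by simp
    rw [hd, h2, dist_comm (γ.toFun 0) p] at h1
    simp only
    linarith

/-- The horoball `{p | β_γ(p) ≥ t}` at the endpoint of `γ`, with `γ(t)` on its frontier when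
`t ≥ 0`. -/
def horoball (γ : Ray M) (t : ℝ) : Set M := {p | t ≤ busemann γ p}

end Boundary

/-! ### Isometric actions -/

section Actions

variable (G : Type u) [Group G] {M : Type z} [MetricSpace M]

/-- The compact-open topology on the set `Hom(G, Isom(M))` of isometric actions of the discrete
group `G` on `M`: `Isom(M)` carries the compact-open topology, and, compact subsets of the discrete
space `G` being finite, maps `G → Isom(M)` carry the product topology. -/
instance : TopologicalSpace (G →* (M ≃ᵢ M)) :=
  TopologicalSpace.induced
    (fun ρ g => (⟨fun p => ρ g p, (ρ g).continuous⟩ : C(M, M)))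
    (Pi.topologicalSpace (t₂ := fun _ => ContinuousMap.compactOpen))

/-- The isometric actions of `G` on `M` that leave the set `E` of boundary points invariant. -/
def actionsPreserving (E : Set (Boundary M)) : Set (G →* (M ≃ᵢ M)) :=
  {ρ | ∀ g : G, Boundary.map (ρ g) '' E = E}

variable {G}

/-- All orbits of the action are discrete subsets of `M`. -/
def HasDiscreteOrbits (ρ : G →* (M ≃ᵢ M)) : Prop :=
  ∀ p : M, DiscreteTopology (range fun g : G => ρ g p)

/-- The translates of some compact subset of `M` cover `M`. -/
def IsCocompact (ρ : G →* (M ≃ᵢ M)) : Prop :=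
  ∃ K : Set M, IsCompact K ∧ ∀ p : M, ∃ g : G, ∃ k ∈ K, ρ g k = p

/-- The stabilizer `G_b` of the point `b` under the action `ρ`. -/
def stabilizer (ρ : G →* (M ≃ᵢ M)) (b : M) : Subgroup G where
  carrier := {g | ρ g b = b}
  one_mem' := by simp
  mul_mem' := by
    intro g k hg hk
    simp only [mem_ofPred_eq] at hg hk ⊢
    rw [map_mul, IsometryEquiv.mul_apply, hk, hg]
  inv_mem' := by
    intro g hg
    simp only [mem_ofPred_eq] at hg ⊢
    rw [map_inv]
    calc (ρ g)⁻¹ b = (ρ g)⁻¹ (ρ g b) := by rw [hg]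
      _ = b := IsometryEquiv.inv_apply_self _ _

/-- The `G`-module `A` is finitely generated as an `H`-module. -/
def FinitelyGeneratedOver (H : Subgroup G) (A : Type w) [AddCommGroup A] [DistribMulAction G A] :
    Prop :=
  ∃ S : Finset A, AddSubgroup.closure {a : A | ∃ g ∈ H, ∃ s ∈ S, a = g • s} = ⊤

end Actions

/-! ### Controlled free modules -/

section FreeModules

variable (G : Type u) [Group G] (X : Type v)

/-- The free `G`-module on `X`: the free abelian group on the free `G`-set `Y = G × X`, where
`(g, x)` stands for `gx`. The support of `c` in `Y` is `c.support`. -/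
abbrev FreeGModule : Type max u v := (G × X) →₀ ℤ

variable {G X}

/-- The action of `G` on the free `G`-module, `g (k x) = (g k) x`. -/
def translate (g : G) : FreeGModule G X →+ FreeGModule G X :=
  Finsupp.mapDomain.addMonoidHom fun y => (g * y.1, y.2)

/-- `Φ` is a `G`-volley on the free `G`-module `F`: a `G`-equivariant map from `F` to the set of
finite subsets of `F`. -/
structure IsVolley (Φ : FreeGModule G X → Set (FreeGModule G X)) : Prop where
  finite : ∀ c, (Φ c).Finite
  equivariant : ∀ (g : G) (c : FreeGModule G X), Φ (translate g c) = translate g '' Φ c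

/-- The additive endomorphism `φ` is a selection from `Φ`. -/
def IsSelection (Φ : FreeGModule G X → Set (FreeGModule G X))
    (φ : FreeGModule G X →+ FreeGModule G X) : Prop :=
  ∀ c, φ c ∈ Φ c

/-- The additive endomorphism `φ` is `G`-finitary. -/
def IsFinitary (φ : FreeGModule G X →+ FreeGModule G X) : Prop :=
  ∃ Φ : FreeGModule G X → Set (FreeGModule G X), IsVolley Φ ∧ IsSelection Φ φ

variable {M : Type z} [MetricSpace M] (ρ : G →* (M ≃ᵢ M)) (h : X → Finset M)

/-- The control map `F → fM` of the `G`-space `M` (with action `ρ`) that is determined by its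
values `h x` on the basis `X`; it sends `c` to the union of the sets `g h(x)` over all `gx` in the
support of `c`. -/
def control (c : FreeGModule G X) : Set M :=
  ⋃ y ∈ c.support, ρ y.1 '' (h y.2 : Set M)

/-- The valuation `v_γ(c) = min β_γ(h(c))`, with `v_γ(0) = ∞`. -/
def valuation (γ : Ray M) (c : FreeGModule G X) : EReal :=
  ⨅ p ∈ control ρ h c, (busemann γ p : EReal)

/-- The guaranteed shift `gsh_e(φ) = inf_c (v_γ(φ(c)) - v_γ(c))`, where `γ` is a ray with endpoint
`e`; in a CAT(0) space the difference does not depend on the choice of `γ`, so that the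
infimum over `γ` is that of a constant. The element `c = 0` imposes no condition
(`∞ - ∞` is read as `∞`). -/
def guaranteedShift (e : Boundary M) (φ : FreeGModule G X →+ FreeGModule G X) : EReal :=
  ⨅ (γ : Ray M) (_ : γ.endpoint = e) (c : FreeGModule G X) (_ : c ≠ 0),
    (valuation ρ h γ (φ c) - valuation ρ h γ c)

variable {A : Type w} [AddCommGroup A] (ε : FreeGModule G X →+ A)

/-- The horospherical limit set `Σ(M;A)`, computed from the presentation `ε : F → A` and the
control map given by `h`: the set of all `e ∈ ∂M` such that each element of `A` is supported over
every horoball at `e`. -/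
def horosphericalLimitSet : Set (Boundary M) :=
  {e | ∀ γ : Ray M, γ.endpoint = e → ∀ (t : ℝ) (a : A),
    ∃ c : FreeGModule G X, ε c = a ∧ control ρ h c ⊆ horoball γ t}

/-- The dynamical limit set `°Σ(M;A)`, computed from the presentation `ε : F → A` and the control
map given by `h`: the set of all `e ∈ ∂M` towards which some `G`-finitary endomorphism of `F` that
induces the identity of `A` pushes `F`. -/
def dynamicalLimitSet : Set (Boundary M) :=
  {e | ∃ φ : FreeGModule G X →+ FreeGModule G X,
    IsFinitary φ ∧ (∀ c, ε (φ c) = ε c) ∧ 0 < guaranteedShift ρ h e φ}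

end FreeModules

end HoroLimit

end

open HoroLimit

/-!
The three assertions rest on the same principle: a condition on all of `M` or on all of a closed
set of boundary points is witnessed, by compactness, by finitely many chains of the free module
`F`, and equivariance spreads these over the whole of `F`. As finitely many chains involve only
finitely many points `ρ g p`, and an isometric action depends on `ρ` continuously there, the same
chains still work for every action close to `ρ`.

For the horospherical limit set, let `e ∈ E` be the endpoint of a ray `γ₀` from `b`. The
hypothesis `e ∈ Σ` allows each generator `x` to be replaced by a chain with the same image in `A`
that is higher by `3` with respect to the Busemann function of `γ₀`. Busemann functions of rays
from `b` depend continuously on the ray and are `1`-Lipschitz in the point, and the rays from `b`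
with endpoint in `E` form a compact space; so finitely many such chains serve all `e ∈ E` and all
nearby actions, with a gain of `1`. Their `G`-translates generate a volley, and a selection for
`e` uses over `gx` the `g`-translate of a chain that is good for `g⁻¹e`, which again lies in `E`
(`exists_volley_eventually_le_guaranteedShift`). The second assertion is the case `E = ∂M`,
because iterating a finitary endomorphism that shifts towards `e` shows that the dynamical limit
set lies in the horospherical one (`dynamicalLimitSet_subset_horosphericalLimitSet`).

The geometry used is one consequence of the CAT(0) inequality (`IsCAT0.dist_add_dist_le`): a
detour from `q` to `z` over a point of `[p, z]` far away from `p` costs arbitrarily little,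
uniformly in `z`. It yields the continuity of Busemann functions in the ray
(`IsCAT0.continuous_busemann`) and the fact that those of asymptotic rays differ by a constant
(`IsCAT0.busemann_sub_eq_of_asymptotic`).

The third assertion does not need the boundary. A cocompact action for which `A` is finitely
generated over `G_b` has a radius `r` such that over each ball of radius `r` in `M` every element
of `A` is represented by a chain; for discrete orbits the converse holds for the ball around `b`.
Such an action allows each generator to be moved towards any far away point by a definite amount,
and finitely many chains achieve this for all nearby actions. Repeated moves then replace
every chain by one with the same image in `A` within a fixed distance of any given point
(`eventually_isSupportedNear`). Applied to the augmentation `ℤG → ℤ`, the same argument shows that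
cocompactness persists.
-/

namespace HoroLimit

/-! ### Translation on the free module, volleys and their selections -/

section Volleys

variable {G : Type*} {X : Type*}

/-- The additive endomorphism of the free `G`-module with prescribed values on the `ℤ`-basis. -/
noncomputable def additiveExtension (f : G × X → FreeGModule G X) :
    FreeGModule G X →+ FreeGModule G X :=
  Finsupp.liftAddHom fun y => zmultiplesHom (FreeGModule G X) (f y)

theorem additiveExtension_apply (f : G × X → FreeGModule G X) (c : FreeGModule G X) :
    additiveExtension f c = c.sum fun y n => n • f y :=
  rfl

theorem map_additiveExtension {A : Type*} [AddCommGroup A] (ε : FreeGModule G X →+ A)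
    (f : G × X → FreeGModule G X) (hf : ∀ y, ε (f y) = ε (Finsupp.single y 1))
    (c : FreeGModule G X) : ε (additiveExtension f c) = ε c := by
  have : ε.comp (additiveExtension f) = ε := by
    refine Finsupp.addHom_ext' fun y => AddMonoidHom.ext_int ?_
    simp [additiveExtension_apply, hf]
  exact DFunLike.congr_fun this c

theorem exists_of_mem_support_additiveExtension {f : G × X → FreeGModule G X}
    {c : FreeGModule G X} {z : G × X} (hz : z ∈ (additiveExtension f c).support) :
    ∃ y ∈ c.support, z ∈ (f y).support := by
  classical
  rw [additiveExtension_apply] at hz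
  obtain ⟨y, hy, hzy⟩ := Finset.mem_biUnion.1 (Finsupp.support_sum hz)
  exact ⟨y, hy, Finsupp.support_smul hzy⟩

variable [Group G]

theorem translate_single (g k : G) (x : X) (n : ℤ) :
    translate g (Finsupp.single (k, x) n) = Finsupp.single (g * k, x) n :=
  Finsupp.mapDomain_single

theorem translate_translate (g k : G) (c : FreeGModule G X) :
    translate g (translate k c) = translate (g * k) c := by
  simp only [translate, Finsupp.mapDomain.addMonoidHom_apply]
  rw [← Finsupp.mapDomain_comp]
  congr 1
  funext y
  simp [mul_assoc]

theorem translate_one (c : FreeGModule G X) : translate 1 c = c := by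
  simp only [translate, Finsupp.mapDomain.addMonoidHom_apply, one_mul]
  exact Finsupp.mapDomain_id

theorem exists_of_mem_support_translate {g : G} {c : FreeGModule G X} {y : G × X}
    (hy : y ∈ (translate g c).support) : ∃ z ∈ c.support, y = (g * z.1, z.2) := by
  classical
  have := Finsupp.mapDomain_support (f := fun y : G × X => (g * y.1, y.2)) (s := c) hy
  obtain ⟨z, hz, rfl⟩ := Finset.mem_image.1 this
  exact ⟨z, hz, rfl⟩

/-- The volley obtained from a choice of finite sets `C x` of candidate images of the generators
`x`: the candidates for `gx` are the `g`-translates of those for `x`, and the candidates for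
`∑ n_y y` are all sums `∑ n_y c_y` with `c_y` a candidate for `y`. -/
def volleyOf (C : X → Set (FreeGModule G X)) (c : FreeGModule G X) : Set (FreeGModule G X) :=
  {c' | ∃ f : G × X → FreeGModule G X, (∀ y, f y ∈ translate y.1 '' C y.2) ∧
    additiveExtension f c = c'}

theorem isSelection_additiveExtension {C : X → Set (FreeGModule G X)}
    {f : G × X → FreeGModule G X} (hf : ∀ y, f y ∈ translate y.1 '' C y.2) :
    IsSelection (volleyOf C) (additiveExtension f) :=
  fun _ => ⟨f, hf, rfl⟩

theorem translate_mem_volleyOf {C : X → Set (FreeGModule G X)} (g : G)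
    {c c' : FreeGModule G X} (hc : c' ∈ volleyOf C c) :
    translate g c' ∈ volleyOf C (translate g c) := by
  obtain ⟨f, hf, rfl⟩ := hc
  refine ⟨fun y => translate g (f (g⁻¹ * y.1, y.2)), fun y => ?_, ?_⟩
  · obtain ⟨d, hd, hdf⟩ := hf (g⁻¹ * y.1, y.2)
    exact ⟨d, hd, by simp only [← hdf, translate_translate, mul_inv_cancel_left]⟩
  · have : (additiveExtension fun y => translate g (f (g⁻¹ * y.1, y.2))).comp (translate g) =
        (translate g).comp (additiveExtension f) := by
      refine Finsupp.addHom_ext' fun ⟨k, x⟩ => AddMonoidHom.ext_int ?_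
      simp [additiveExtension_apply, translate_single]
    exact DFunLike.congr_fun this c

theorem isVolley_volleyOf {C : X → Set (FreeGModule G X)} (hC : ∀ x, (C x).Finite) :
    IsVolley (volleyOf C) where
  finite c := by
    have hfin : (Set.univ.pi fun y : c.support => translate y.1.1 '' C y.1.2).Finite :=
      Set.Finite.pi fun y => (hC y.1.2).image _
    refine (hfin.image fun f => ∑ y : c.support, c y • f y).subset ?_
    rintro _ ⟨f, hf, rfl⟩
    refine ⟨fun y => f y, fun y _ => hf y, ?_⟩
    rw [additiveExtension_apply]
    exact Finset.sum_coe_sort c.support fun y => c y • f y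
  equivariant g c := by
    apply Subset.antisymm
    · intro d hd
      have := translate_mem_volleyOf g⁻¹ hd
      rw [translate_translate, inv_mul_cancel, translate_one] at this
      exact ⟨_, this, by rw [translate_translate, mul_inv_cancel, translate_one]⟩
    · rintro _ ⟨d, hd, rfl⟩
      exact translate_mem_volleyOf g hd

theorem image_volleyOf {A : Type*} [AddCommGroup A] [DistribMulAction G A]
    {ε : FreeGModule G X →+ A} (hεG : ∀ (g : G) (c : FreeGModule G X), ε (translate g c) = g • ε c)
    {C : X → Set (FreeGModule G X)} (hC : ∀ x, ∀ c ∈ C x, ε c = ε (Finsupp.single (1, x) 1))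
    (hne : ∀ x, (C x).Nonempty) (c : FreeGModule G X) : ε '' volleyOf C c = {ε c} := by
  have key : ∀ f : G × X → FreeGModule G X, (∀ y, f y ∈ translate y.1 '' C y.2) →
      ε (additiveExtension f c) = ε c := by
    intro f hf
    refine map_additiveExtension ε f (fun y => ?_) c
    obtain ⟨d, hd, hdf⟩ := hf y
    rw [← hdf, hεG, hC _ d hd, ← hεG, translate_single, mul_one]
  apply Subset.antisymm
  · rintro _ ⟨_, ⟨f, hf, rfl⟩, rfl⟩
    exact key f hf
  · rintro _ rfl
    choose d hd using hne
    have hf : ∀ y : G × X, translate y.1 (d y.2) ∈ translate y.1 '' C y.2 :=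
      fun y => ⟨_, hd _, rfl⟩
    exact ⟨_, ⟨_, hf, rfl⟩, key _ hf⟩

end Volleys

/-! ### Valuations and guaranteed shifts -/

section Shift

variable {G : Type*} [Group G] {X : Type*} {M : Type*} [MetricSpace M]
  {ρ : G →* (M ≃ᵢ M)} {h : X → Finset M}

theorem le_valuation_iff {γ : Ray M} {c : FreeGModule G X} {r : EReal} :
    r ≤ valuation ρ h γ c ↔
      ∀ y ∈ c.support, ∀ p ∈ h y.2, r ≤ (busemann γ (ρ y.1 p) : EReal) := by
  simp only [valuation, control, le_iInf_iff, mem_iUnion]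
  constructor
  · intro H y hy p hp
    exact H _ ⟨y, hy, p, hp, rfl⟩
  · rintro H _ ⟨y, hy, p, hp, rfl⟩
    exact H y hy p hp

theorem valuation_le {γ : Ray M} {c : FreeGModule G X} {y : G × X} (hy : y ∈ c.support)
    {p : M} (hp : p ∈ h y.2) : valuation ρ h γ c ≤ (busemann γ (ρ y.1 p) : EReal) :=
  le_valuation_iff.1 le_rfl y hy p hp

theorem exists_valuation_eq_coe (hh : ∀ x, (h x).Nonempty) (γ : Ray M) {c : FreeGModule G X}
    (hc : c ≠ 0) : ∃ r : ℝ, valuation ρ h γ c = r := by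
  obtain ⟨y, hy⟩ := Finsupp.support_nonempty_iff.2 hc
  obtain ⟨p, hp⟩ := hh y.2
  have htop : valuation ρ h γ c ≠ ⊤ := ne_top_of_le_ne_top (EReal.coe_ne_top _) (valuation_le hy hp)
  have hbot : valuation ρ h γ c ≠ ⊥ := by
    -- finitely many real values are bounded below by a real number
    obtain ⟨r, hr⟩ : BddBelow ((fun z : G × M => busemann γ (ρ z.1 z.2)) ''
        ⋃ y ∈ (c.support : Set (G × X)), (fun p => (y.1, p)) '' (h y.2 : Set M)) :=
      ((c.support.finite_toSet.biUnion fun y _ => (h y.2).finite_toSet.image _).image _).bddBelow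
    have : (r : EReal) ≤ valuation ρ h γ c := le_valuation_iff.2 fun y hy p hp =>
      EReal.coe_le_coe_iff.2 (hr ⟨(y.1, p), mem_biUnion (by exact hy) ⟨p, hp, rfl⟩, rfl⟩)
    exact ne_bot_of_le_ne_bot (EReal.coe_ne_bot r) this
  exact ⟨_, (EReal.coe_toReal htop hbot).symm⟩

theorem le_guaranteedShift_iff (hh : ∀ x, (h x).Nonempty) {e : Boundary M}
    {φ : FreeGModule G X →+ FreeGModule G X} {ν : ℝ} :
    (ν : EReal) ≤ guaranteedShift ρ h e φ ↔ ∀ γ : Ray M, γ.endpoint = e →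
      ∀ c : FreeGModule G X, c ≠ 0 → ν + valuation ρ h γ c ≤ valuation ρ h γ (φ c) := by
  simp only [guaranteedShift, le_iInf_iff]
  refine forall₄_congr fun γ _ c hc => ?_
  obtain ⟨r, hr⟩ := exists_valuation_eq_coe (ρ := ρ) hh γ hc
  rw [hr]
  exact EReal.le_sub_iff_add_le (Or.inl (EReal.coe_ne_bot r)) (Or.inl (EReal.coe_ne_top r))

/-- It suffices to bound the shift on the `ℤ`-basis: the valuation of a sum is at least the minimum
of the valuations of its terms. -/
theorem le_guaranteedShift_additiveExtension (hh : ∀ x, (h x).Nonempty) {e : Boundary M}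
    {f : G × X → FreeGModule G X} {ν : ℝ}
    (H : ∀ γ : Ray M, γ.endpoint = e → ∀ y : G × X, ∀ z ∈ (f y).support, ∀ p ∈ h z.2,
      ∃ q ∈ h y.2, ν + busemann γ (ρ y.1 q) ≤ busemann γ (ρ z.1 p)) :
    (ν : EReal) ≤ guaranteedShift ρ h e (additiveExtension f) := by
  rw [le_guaranteedShift_iff hh]
  intro γ hγ c _
  rw [le_valuation_iff]
  intro z hz p hp
  obtain ⟨y, hy, hzy⟩ := exists_of_mem_support_additiveExtension hz
  obtain ⟨q, hq, hle⟩ := H γ hγ y z hzy p hp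
  calc (ν : EReal) + valuation ρ h γ c ≤ ν + (busemann γ (ρ y.1 q) : EReal) := by
        gcongr
        exact valuation_le hy hq
    _ ≤ (busemann γ (ρ z.1 p) : EReal) := by exact_mod_cast hle

/-- A finitary endomorphism that induces the identity and shifts towards `e` can be iterated, and
thus pushes every element into every horoball at `e`. -/
theorem dynamicalLimitSet_subset_horosphericalLimitSet (hh : ∀ x, (h x).Nonempty)
    {A : Type*} [AddCommGroup A] {ε : FreeGModule G X →+ A} (hε : Function.Surjective ε) :
    dynamicalLimitSet ρ h ε ⊆ horosphericalLimitSet ρ h ε := by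
  rintro e ⟨φ, -, hφ, hpos⟩ γ hγ t a
  obtain ⟨ν, hν0, hν⟩ := EReal.lt_iff_exists_real_btwn.1 hpos
  have hν0 : 0 < ν := by exact_mod_cast hν0
  have hshift := (le_guaranteedShift_iff hh).1 hν.le γ hγ
  obtain ⟨c, rfl⟩ := hε a
  have hreach : ∀ s : ℝ, (∃ c' : FreeGModule G X, ε c' = ε c ∧ (s : EReal) ≤ valuation ρ h γ c') →
      ∀ n : ℕ, ∃ c' : FreeGModule G X, ε c' = ε c ∧
        ((s + n * ν : ℝ) : EReal) ≤ valuation ρ h γ c' := by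
    intro s hs n
    induction n with
    | zero => simpa using hs
    | succ n ih =>
      obtain ⟨c', hc', hle⟩ := ih
      by_cases h0 : c' = 0
      · refine ⟨0, by rw [← hc', h0], ?_⟩
        rw [le_valuation_iff]
        simp
      · refine ⟨φ c', by rw [hφ, hc'], le_trans ?_ (hshift c' h0)⟩
        calc ((s + (n + 1 : ℕ) * ν : ℝ) : EReal) = (ν : EReal) + ((s + n * ν : ℝ) : EReal) := by
              rw [← EReal.coe_add]
              congr 1
              push_cast
              ring
          _ ≤ _ := by gcongr
  obtain ⟨s, hs⟩ : ∃ s : ℝ, (s : EReal) ≤ valuation ρ h γ c := by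
    by_cases h0 : c = 0
    · refine ⟨0, ?_⟩
      rw [le_valuation_iff, h0]
      simp
    · obtain ⟨r, hr⟩ := exists_valuation_eq_coe (ρ := ρ) hh γ h0
      exact ⟨r, hr.ge⟩
  obtain ⟨n, hn⟩ := exists_nat_gt ((t - s) / ν)
  obtain ⟨c', hc', hle⟩ := hreach s ⟨c, rfl, hs⟩ n
  refine ⟨c', hc', ?_⟩
  intro q hq
  simp only [control, mem_iUnion] at hq
  obtain ⟨y, hy, p, hp, rfl⟩ := hq
  have h1 := EReal.coe_le_coe_iff.1 (le_valuation_iff.1 hle y hy p hp)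
  rw [div_lt_iff₀ hν0] at hn
  show t ≤ busemann γ (ρ y.1 p)
  linarith

end Shift


/-! ### The space of actions -/

section ActionSpace

variable {G : Type*} [Group G] {M : Type*} [MetricSpace M]

theorem action_mul_apply (ρ : G →* (M ≃ᵢ M)) (g k : G) (p : M) :
    ρ (g * k) p = ρ g (ρ k p) := by
  rw [map_mul, IsometryEquiv.mul_apply]

theorem action_one_apply (ρ : G →* (M ≃ᵢ M)) (p : M) : ρ 1 p = p := by
  rw [map_one, IsometryEquiv.coe_one, id]

theorem dist_action_inv (ρ : G →* (M ≃ᵢ M)) (g : G) (p q : M) :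
    dist p (ρ g⁻¹ q) = dist (ρ g p) q := by
  rw [← (ρ g).isometry.dist_eq p, ← action_mul_apply, mul_inv_cancel, action_one_apply]

theorem continuous_action_apply (g : G) (p : M) :
    Continuous fun ρ : G →* (M ≃ᵢ M) => ρ g p := by
  have h1 : Continuous fun ρ : G →* (M ≃ᵢ M) => fun g : G =>
      (⟨fun p => ρ g p, (ρ g).continuous⟩ : C(M, M)) := continuous_induced_dom
  exact (ContinuousEvalConst.continuous_eval_const (F := C(M, M)) p).comp
    ((continuous_apply g).comp h1)

theorem eventually_forall_dist_lt {S : Set (G × M)} (hS : S.Finite) (ρ : G →* (M ≃ᵢ M)) {δ : ℝ}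
    (hδ : 0 < δ) : ∀ᶠ ρ' in 𝓝 ρ, ∀ y ∈ S, dist (ρ' y.1 y.2) (ρ y.1 y.2) < δ :=
  (eventually_all_finite hS).2 fun y _ =>
    (continuous_action_apply y.1 y.2).continuousAt.eventually (Metric.ball_mem_nhds _ hδ)

end ActionSpace

/-! ### Bounded support around every point, and its stability -/

section BoundedSupport

variable {G : Type*} [Group G] {X : Type*} {M : Type*} [MetricSpace M]
  {A : Type*} [AddCommGroup A]

/-- Every element of `A` is the image of a chain whose support lies, via the orbit map `g ↦ ρ g b`,
within distance `r` of the point `p`. -/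
def IsSupportedNear (ρ : G →* (M ≃ᵢ M)) (b : M) (ε : FreeGModule G X →+ A) (p : M) (r : ℝ) :
    Prop :=
  ∀ a : A, ∃ c : FreeGModule G X, ε c = a ∧ ∀ y ∈ c.support, dist (ρ y.1 b) p ≤ r

theorem IsCAT0.exists_between (hM : IsCAT0 M) {p q : M} {r : ℝ} (h0 : 0 ≤ r)
    (hr : r ≤ dist p q) : ∃ x, dist p x = r ∧ dist x q = dist p q - r := by
  obtain ⟨γ, h1, h2, h3⟩ := hM.geodesic p q
  refine ⟨γ r, ?_, ?_⟩
  · have := h3 0 ⟨le_rfl, dist_nonneg⟩ r ⟨h0, hr⟩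
    rwa [h1, zero_sub, abs_neg, abs_of_nonneg h0] at this
  · have := h3 r ⟨h0, hr⟩ (dist p q) ⟨dist_nonneg, le_rfl⟩
    rwa [h2, abs_sub_comm, abs_of_nonneg (sub_nonneg.2 hr)] at this

/-- If every generator `x` can be replaced by a chain that is closer by `1` to any given far away
point, then every chain can be moved to within a fixed distance of any given point. -/
theorem isSupportedNear_of_forall_exists_closer {ρ : G →* (M ≃ᵢ M)} {b : M}
    {ε : FreeGModule G X →+ A} (hε : Function.Surjective ε)
    (hker : ∀ (g : G) (c : FreeGModule G X), ε c = 0 → ε (translate g c) = 0) {L : ℝ}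
    (hpush : ∀ (x : X) (p : M), L ≤ dist b p → ∃ c : FreeGModule G X,
      ε c = ε (Finsupp.single (1, x) 1) ∧ ∀ y ∈ c.support, dist (ρ y.1 b) p ≤ dist b p - 1)
    (p : M) : IsSupportedNear ρ b ε p L := by
  classical
  let F : ℝ → Submodule ℤ (FreeGModule G X) := fun r =>
    Finsupp.supported ℤ ℤ {y | dist (ρ y.1 b) p ≤ r}
  let I : ℝ → Submodule ℤ A := fun r => (F r).map ε.toIntLinearMap
  have hstep : ∀ n : ℕ, I (L + (n + 1 : ℕ)) ≤ I (L + n) := by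
    intro n
    simp only [I, F]
    rw [Finsupp.supported_eq_span_single, Submodule.map_le_iff_le_comap, Submodule.span_le]
    rintro _ ⟨⟨g, x⟩, hy, rfl⟩
    simp only [mem_ofPred_eq] at hy
    push_cast at hy
    by_cases hle : dist (ρ g b) p ≤ L + n
    · exact ⟨_, Finsupp.single_mem_supported ℤ 1 hle, rfl⟩
    · have hd : dist b (ρ g⁻¹ p) = dist (ρ g b) p := dist_action_inv ρ g b p
      obtain ⟨c, hc, hclose⟩ := hpush x (ρ g⁻¹ p) (by
        rw [hd]
        have : (0 : ℝ) ≤ n := n.cast_nonneg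
        linarith)
      refine ⟨translate g c, ?_, ?_⟩
      · simp only [SetLike.mem_coe, Finsupp.mem_supported]
        intro z hz
        obtain ⟨y, hy', rfl⟩ := exists_of_mem_support_translate hz
        have h1 := hclose y hy'
        have h2 : dist (ρ y.1 b) (ρ g⁻¹ p) = dist (ρ (g * y.1) b) p := by
          rw [dist_action_inv, action_mul_apply]
        rw [hd, h2] at h1
        simp only [mem_ofPred_eq]
        linarith
      · have h0 := hker g (c - Finsupp.single (1, x) 1) (by rw [map_sub, hc, sub_self])
        rw [map_sub, map_sub, translate_single, mul_one, sub_eq_zero] at h0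
        exact h0
  have hdesc : ∀ n : ℕ, I (L + n) ≤ I L := by
    intro n
    induction n with
    | zero => simp
    | succ n ih => exact (hstep n).trans ih
  intro a
  obtain ⟨c, rfl⟩ := hε a
  obtain ⟨r, hr⟩ := (c.support.finite_toSet.image fun y => dist (ρ y.1 b) p).bddAbove
  obtain ⟨n, hn⟩ := exists_nat_gt (r - L)
  have hc : ε c ∈ I (L + n) := ⟨c, fun y hy => by
    have := hr ⟨y, hy, rfl⟩
    simp only [mem_ofPred_eq] at this ⊢
    linarith, rfl⟩
  obtain ⟨c', hc', h'⟩ := hdesc n hc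
  exact ⟨c', h', fun y hy => hc' hy⟩

/-- Uniformly bounded support around all points is stable under small perturbations of the action:
finitely many chains suffice to move the generators a definite amount towards any far away
point, and this persists for all nearby actions. -/
theorem eventually_isSupportedNear [ProperSpace M] (hM : IsCAT0 M) [Finite X]
    {ρ : G →* (M ≃ᵢ M)} {b : M} {ε : FreeGModule G X →+ A} (hε : Function.Surjective ε)
    (hker : ∀ (g : G) (c : FreeGModule G X), ε c = 0 → ε (translate g c) = 0) {R : ℝ}
    (hR : ∀ p, IsSupportedNear ρ b ε p R) :
    ∀ᶠ ρ' in 𝓝 ρ, ∃ L : ℝ, ∀ p, IsSupportedNear ρ' b ε p L := by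
  have hR' : ∀ (q : M) (x : X), ∃ c : FreeGModule G X, ε c = ε (Finsupp.single (1, x) 1) ∧
    ∀ y ∈ c.support, dist (ρ y.1 b) q ≤ R := fun q x => hR q _
  choose c hc hcR using hR'
  -- `R + 1` bounds the support around a net point; `2` leaves room for the perturbation
  set L : ℝ := max (R + 3) 0 with hL
  obtain ⟨T, -, hT, hcover⟩ := finite_cover_balls_of_compact
    (isCompact_closedBall b L) one_pos
  have hS : (⋃ q ∈ T, ⋃ x : X,
      (fun y : G × X => (y.1, b)) '' ((c q x).support : Set (G × X))).Finite :=
    hT.biUnion fun q _ => Set.finite_iUnion fun x => (Finset.finite_toSet _).image _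
  filter_upwards [eventually_forall_dist_lt hS ρ one_pos] with ρ' hρ'
  refine ⟨L, isSupportedNear_of_forall_exists_closer hε hker fun x p hp => ?_⟩
  obtain ⟨q, hbq, hqp⟩ := hM.exists_between (le_max_right _ _) hp
  obtain ⟨q', hq', hqq'⟩ := mem_iUnion₂.1 (hcover (show q ∈ Metric.closedBall b L by
    rw [Metric.mem_closedBall, dist_comm, hbq]))
  refine ⟨c q' x, hc q' x, fun y hy => ?_⟩
  have h1 := hρ' (y.1, b) (mem_biUnion hq' (mem_iUnion.2 ⟨x, y, hy, rfl⟩))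
  have h2 := hcR q' x y hy
  have h3 : dist q q' < 1 := hqq'
  have h4 := dist_triangle4 (ρ' y.1 b) (ρ y.1 b) q' q
  have h5 := dist_triangle (ρ' y.1 b) q p
  rw [dist_comm q' q] at h4
  have h6 : R + 3 ≤ L := le_max_left _ _
  simp only at h1
  linarith

end BoundedSupport

/-! ### Cocompactness and finite generation over the stabilizer -/

section Cocompact

variable {G : Type*} {X : Type*} {M : Type*} [MetricSpace M] {A : Type*} [AddCommGroup A]

/-- The augmentation of `ℤG`, the presentation of the trivial module `ℤ`. -/
noncomputable def augmentation (G : Type*) : ((G × Unit) →₀ ℤ) →+ ℤ :=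
  Finsupp.liftAddHom fun _ => AddMonoidHom.id ℤ

theorem augmentation_single (y : G × Unit) (n : ℤ) :
    augmentation G (Finsupp.single y n) = n := by
  simp [augmentation]

variable [Group G]

theorem isCocompact_iff [ProperSpace M] {ρ : G →* (M ≃ᵢ M)} (b : M) :
    IsCocompact ρ ↔ ∃ R : ℝ, ∀ p, ∃ g, dist (ρ g b) p ≤ R := by
  constructor
  · rintro ⟨K, hK, hcov⟩
    obtain ⟨R, hR⟩ := hK.isBounded.subset_closedBall b
    refine ⟨R, fun p => ?_⟩
    obtain ⟨g, k, hk, rfl⟩ := hcov p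
    refine ⟨g, ?_⟩
    rw [(ρ g).isometry.dist_eq, dist_comm]
    exact hR hk
  · rintro ⟨R, hR⟩
    refine ⟨Metric.closedBall b R, isCompact_closedBall b R, fun p => ?_⟩
    obtain ⟨g, hg⟩ := hR p
    refine ⟨g, (ρ g).symm p, ?_, (ρ g).apply_symm_apply p⟩
    rw [Metric.mem_closedBall, dist_comm, ← (ρ g).isometry.dist_eq, (ρ g).apply_symm_apply]
    exact hg

theorem augmentation_translate (g : G) (c : FreeGModule G Unit) :
    augmentation G (translate g c) = augmentation G c := by
  have : (augmentation G).comp (translate g) = augmentation G := by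
    refine Finsupp.addHom_ext' fun ⟨k, x⟩ => AddMonoidHom.ext_int ?_
    simp [translate_single, augmentation_single]
  exact DFunLike.congr_fun this c

theorem isSupportedNear_augmentation_iff {ρ : G →* (M ≃ᵢ M)} {b p : M} {r : ℝ} :
    IsSupportedNear ρ b (augmentation G) p r ↔ ∃ g, dist (ρ g b) p ≤ r := by
  constructor
  · intro H
    obtain ⟨c, hc, hr⟩ := H 1
    have h0 : c ≠ 0 := by
      rintro rfl
      simp at hc
    obtain ⟨y, hy⟩ := Finsupp.support_nonempty_iff.2 h0
    exact ⟨y.1, hr y hy⟩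
  · rintro ⟨g, hg⟩ n
    refine ⟨Finsupp.single (g, ()) n, augmentation_single _ _, fun y hy => ?_⟩
    obtain rfl := Finset.mem_singleton.1 (Finsupp.support_single_subset hy)
    exact hg

theorem exists_isSupportedNear_of_finitelyGeneratedOver [DistribMulAction G A]
    {ρ : G →* (M ≃ᵢ M)} {b : M} {ε : FreeGModule G X →+ A}
    (hεG : ∀ (g : G) (c : FreeGModule G X), ε (translate g c) = g • ε c)
    (hε : Function.Surjective ε) (hfg : FinitelyGeneratedOver (stabilizer ρ b) A) {R : ℝ}
    (hR : ∀ p, ∃ g, dist (ρ g b) p ≤ R) : ∃ r : ℝ, ∀ p, IsSupportedNear ρ b ε p r := by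
  classical
  obtain ⟨S, hS⟩ := hfg
  choose c hc using hε
  obtain ⟨r, hr⟩ := ((S.finite_toSet.biUnion fun a _ => (c a).support.finite_toSet).image
    fun y => dist (ρ y.1 b) b).bddAbove
  have hb : IsSupportedNear ρ b ε b r := by
    let I : AddSubgroup A := AddSubgroup.map ε
      (Finsupp.supported ℤ ℤ {y : G × X | dist (ρ y.1 b) b ≤ r}).toAddSubgroup
    have hI : I = ⊤ := by
      rw [eq_top_iff, ← hS, AddSubgroup.closure_le]
      rintro _ ⟨g, hg, s, hs, rfl⟩
      refine ⟨translate g (c s), fun z hz => ?_, by rw [hεG, hc]⟩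
      obtain ⟨y, hy, rfl⟩ := exists_of_mem_support_translate hz
      have hg : ρ g b = b := hg
      have h1 : dist (ρ y.1 b) b ≤ r := hr ⟨y, mem_biUnion (by exact hs) hy, rfl⟩
      simp only [mem_ofPred_eq, action_mul_apply]
      rwa [← (ρ g).isometry.dist_eq, hg] at h1
    intro a
    obtain ⟨d, hd, hda⟩ : a ∈ I := by simp [hI]
    exact ⟨d, hda, fun y hy => hd hy⟩
  refine ⟨r + R, fun p a => ?_⟩
  obtain ⟨g, hg⟩ := hR p
  obtain ⟨d, hd, hdr⟩ := hb (g⁻¹ • a)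
  refine ⟨translate g d, by rw [hεG, hd, smul_inv_smul], fun z hz => ?_⟩
  obtain ⟨y, hy, rfl⟩ := exists_of_mem_support_translate hz
  have h1 := hdr y hy
  have h2 := dist_triangle (ρ (g * y.1) b) (ρ g b) p
  have h3 : dist (ρ (g * y.1) b) (ρ g b) = dist (ρ y.1 b) b := by
    rw [action_mul_apply, (ρ g).isometry.dist_eq]
  simp only
  linarith

theorem HasDiscreteOrbits.finite_orbit_inter_closedBall [ProperSpace M] {ρ : G →* (M ≃ᵢ M)}
    (hρ : HasDiscreteOrbits ρ) (b : M) (L : ℝ) :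
    ((range fun g : G => ρ g b) ∩ Metric.closedBall b L).Finite := by
  have := hρ b
  obtain ⟨δ, hδ, hiso⟩ := Metric.exists_ball_inter_eq_singleton_of_mem_discrete (IsDiscrete.mk this)
    (show b ∈ range fun g : G => ρ g b from ⟨1, by simp⟩)
  -- by homogeneity all points of the orbit are isolated with the same radius
  have hsep : ∀ g k : G, dist (ρ g b) (ρ k b) < δ → ρ g b = ρ k b := by
    intro g k hgk
    have hmem : ρ (k⁻¹ * g) b ∈ Metric.ball b δ ∩ range fun g : G => ρ g b := by
      refine ⟨?_, mem_range_self _⟩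
      rw [Metric.mem_ball, ← (ρ k).isometry.dist_eq, ← action_mul_apply, mul_inv_cancel_left]
      exact hgk
    rw [hiso, mem_singleton_iff] at hmem
    rw [← mul_inv_cancel_left k g, action_mul_apply, hmem]
  obtain ⟨T, -, hT, hcover⟩ := finite_cover_balls_of_compact
    (isCompact_closedBall b L) (half_pos hδ)
  refine (hT.biUnion (t := fun q => (range fun g : G => ρ g b) ∩ Metric.ball q (δ / 2))
    fun q _ => Set.Subsingleton.finite ?_).subset ?_
  · rintro _ ⟨⟨g, rfl⟩, hg⟩ _ ⟨⟨k, rfl⟩, hk⟩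
    rw [Metric.mem_ball] at hg hk
    exact hsep g k (by linarith [dist_triangle_right (ρ g b) (ρ k b) q])
  · rintro p ⟨hp, hpL⟩
    obtain ⟨q, hq, hpq⟩ := mem_iUnion₂.1 (hcover hpL)
    exact mem_biUnion hq ⟨hp, hpq⟩

theorem finitelyGeneratedOver_of_isSupportedNear [ProperSpace M] [Finite X] [DistribMulAction G A]
    {ρ : G →* (M ≃ᵢ M)} (hρ : HasDiscreteOrbits ρ) {b : M} {ε : FreeGModule G X →+ A}
    (hεG : ∀ (g : G) (c : FreeGModule G X), ε (translate g c) = g • ε c) {L : ℝ}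
    (hL : IsSupportedNear ρ b ε b L) : FinitelyGeneratedOver (stabilizer ρ b) A := by
  classical
  -- the elements moving `b` by at most `L` fall into finitely many right cosets of the stabilizer
  obtain ⟨T, hT⟩ : ∃ T : Set G, T.Finite ∧ ∀ g, dist (ρ g b) b ≤ L →
      ∃ k ∈ stabilizer ρ b, ∃ t ∈ T, g = k * t := by
    choose! s hs using show ∀ p ∈ (range fun g : G => ρ g b) ∩ Metric.closedBall b L,
      ∃ g, ρ g b = p from fun p hp => hp.1
    refine ⟨(fun p => (s p)⁻¹) '' ((range fun g : G => ρ g b) ∩ Metric.closedBall b L),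
      (hρ.finite_orbit_inter_closedBall b L).image _, fun g hg => ?_⟩
    have hmem : ρ g⁻¹ b ∈ (range fun g : G => ρ g b) ∩ Metric.closedBall b L := by
      refine ⟨mem_range_self _, ?_⟩
      rw [Metric.mem_closedBall, dist_comm, dist_action_inv]
      exact hg
    refine ⟨g * s (ρ g⁻¹ b), ?_, _, ⟨_, hmem, rfl⟩, by simp⟩
    show ρ (g * s (ρ g⁻¹ b)) b = b
    rw [action_mul_apply, hs _ hmem, ← action_mul_apply, mul_inv_cancel, action_one_apply]
  have hfin : (range fun z : T × X => ε (Finsupp.single (z.1.1, z.2) 1)).Finite := by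
    have := hT.1.to_subtype
    exact Set.finite_range _
  refine ⟨hfin.toFinset, ?_⟩
  rw [eq_top_iff]
  intro a _
  obtain ⟨c, rfl, hc⟩ := hL a
  rw [← Finsupp.sum_single c, Finsupp.sum, map_sum]
  refine sum_mem fun y hy => ?_
  obtain ⟨k, hk, t, ht, hkt⟩ := hT.2 y.1 (hc y hy)
  have : ε (Finsupp.single y (c y)) = c y • k • ε (Finsupp.single (t, y.2) 1) := by
    rw [← hεG, translate_single, ← hkt, ← map_zsmul]
    simp
  rw [this]
  refine AddSubgroup.zsmul_mem _ (AddSubgroup.subset_closure ?_) _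
  refine ⟨k, hk, _, ?_, rfl⟩
  rw [Set.Finite.mem_toFinset]
  exact ⟨(⟨t, ht⟩, y.2), rfl⟩

/-- Among the actions with discrete orbits, those that are cocompact and over whose stabilizer of
`b` the module is finitely generated form an open set: for these actions the condition says that
both the presentation of `A` and the augmentation of `ℤG` have uniformly bounded support around
every point. -/
theorem isOpen_cocompact_finitelyGeneratedOver [ProperSpace M] (hM : IsCAT0 M) [Finite X]
    [DistribMulAction G A] {ε : FreeGModule G X →+ A}
    (hεG : ∀ (g : G) (c : FreeGModule G X), ε (translate g c) = g • ε c)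
    (hε : Function.Surjective ε) (b : M) :
    IsOpen {ρ : {ρ : G →* (M ≃ᵢ M) // HasDiscreteOrbits ρ} |
      IsCocompact ρ.1 ∧ FinitelyGeneratedOver (stabilizer ρ.1 b) A} := by
  rw [isOpen_iff_mem_nhds]
  rintro ⟨ρ, hρ⟩ ⟨hco, hfg⟩
  obtain ⟨R, hR⟩ := (isCocompact_iff b).1 hco
  obtain ⟨r, hr⟩ := exists_isSupportedNear_of_finitelyGeneratedOver hεG hε hfg hR
  have h1 := eventually_isSupportedNear hM hε
    (fun g c hc => by rw [hεG, hc, smul_zero]) hr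
  have h2 := eventually_isSupportedNear hM (ε := augmentation G)
    (fun n => ⟨Finsupp.single (1, ()) n, augmentation_single _ _⟩)
    (fun g c hc => by rw [augmentation_translate, hc])
    fun p => isSupportedNear_augmentation_iff.2 (hR p)
  filter_upwards [continuous_subtype_val.continuousAt.eventually h1,
    continuous_subtype_val.continuousAt.eventually h2] with ρ' ⟨L, hL⟩ ⟨L', hL'⟩
  exact ⟨(isCocompact_iff b).2 ⟨L', fun p => isSupportedNear_augmentation_iff.1 (hL' p)⟩,
    finitelyGeneratedOver_of_isSupportedNear ρ'.2 hεG (hL b)⟩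

end Cocompact


/-! ### Comparison estimates in CAT(0) spaces -/

section Comparison

variable {M : Type*} [MetricSpace M]

theorem exists_comparison_triangle (p q r : M) : ∃ q₀ r₀ : EuclideanSpace ℝ (Fin 2),
    dist 0 q₀ = dist p q ∧ dist 0 r₀ = dist p r ∧ dist q₀ r₀ = dist q r := by
  have h1 := dist_triangle p q r
  have h2 := dist_triangle q p r
  have h3 := dist_triangle p r q
  rw [dist_comm q p] at h2
  rw [dist_comm r q] at h3
  have ha : 0 ≤ dist p q := dist_nonneg
  have hc : 0 ≤ dist p r := dist_nonneg
  have he : 0 ≤ dist q r := dist_nonneg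
  generalize dist p q = a at *
  generalize dist p r = c at *
  generalize dist q r = e at *
  obtain ⟨u, hu, huc⟩ : ∃ u, 2 * a * u = a ^ 2 + c ^ 2 - e ^ 2 ∧ u ^ 2 ≤ c ^ 2 := by
    rcases ha.eq_or_lt with rfl | ha
    · obtain rfl : c = e := by linarith
      exact ⟨0, by ring, by nlinarith [sq_nonneg c]⟩
    · refine ⟨(a ^ 2 + c ^ 2 - e ^ 2) / (2 * a), by field_simp, ?_⟩
      rw [sq_le_sq, abs_of_nonneg hc, abs_le, le_div_iff₀ (by positivity),
        div_le_iff₀ (by positivity)]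
      constructor
      · nlinarith [mul_nonneg (sub_nonneg.2 h3) (add_nonneg (add_nonneg ha.le hc) he)]
      · nlinarith [mul_nonneg (sub_nonneg.2 h1) (sub_nonneg.2 h2)]
  refine ⟨!₂[a, 0], !₂[u, √(c ^ 2 - u ^ 2)], ?_, ?_, ?_⟩
  · simp [EuclideanSpace.dist_eq, Fin.sum_univ_two, Real.sqrt_sq_eq_abs, abs_of_nonneg ha]
  · simp [EuclideanSpace.dist_eq, Fin.sum_univ_two, Real.dist_eq,
      Real.sq_sqrt (sub_nonneg.2 huc), Real.sqrt_sq_eq_abs, abs_of_nonneg hc]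
  · simp only [EuclideanSpace.dist_eq, Fin.sum_univ_two, Real.dist_eq, sq_abs]
    simp only [Matrix.cons_val_zero, Matrix.cons_val_one, zero_sub, even_two,
      Even.neg_pow, Real.sq_sqrt (sub_nonneg.2 huc)]
    rw [show (a - u) ^ 2 + (c ^ 2 - u ^ 2) = e ^ 2 by linarith, Real.sqrt_sq he]

theorem dist_smul_right_of_le_one {s : ℝ} (hs : s ≤ 1) (v : EuclideanSpace ℝ (Fin 2)) :
    dist (s • v) v = (1 - s) * dist 0 v := by
  rw [dist_comm, dist_eq_norm, show v - s • v = (1 - s) • v by rw [sub_smul, one_smul], norm_smul,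
    Real.norm_of_nonneg (sub_nonneg.2 hs), dist_zero_left]

theorem dist_zero_smul_of_nonneg {s : ℝ} (hs : 0 ≤ s) (v : EuclideanSpace ℝ (Fin 2)) :
    dist 0 (s • v) = s * dist 0 v := by
  rw [dist_zero_left, dist_zero_left, norm_smul, Real.norm_of_nonneg hs]

/-- The distance from a vertex to a point on the opposite side of a geodesic triangle is at most its
value in the Euclidean plane, given by Stewart's theorem. -/
theorem IsCAT0.sq_dist_le (hM : IsCAT0 M) {p q r x : M} {s : ℝ} (h0 : 0 ≤ s) (h1 : s ≤ 1)
    (hpx : dist p x = s * dist p q) (hxq : dist x q = (1 - s) * dist p q) :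
    dist x r ^ 2 ≤
      (1 - s) * dist p r ^ 2 + s * dist q r ^ 2 - s * (1 - s) * dist p q ^ 2 := by
  obtain ⟨q₀, r₀, hq, hr, hqr⟩ := exists_comparison_triangle p q r
  have hle : dist x r ≤ dist (s • q₀) r₀ := by
    refine hM.thin p q r x r 0 q₀ r₀ (s • q₀) r₀ (by rw [hpx, hxq]; ring) (by simp) hq hr hqr ?_ ?_
      hr (by simp)
    · rw [dist_zero_smul_of_nonneg h0, hq, hpx]
    · rw [dist_smul_right_of_le_one h1, hq, hxq]
  have h2 : dist x r ^ 2 ≤ dist (s • q₀) r₀ ^ 2 := by gcongr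
  refine h2.trans_eq ?_
  rw [← hq, ← hr, ← hqr, dist_zero_left, dist_zero_left, dist_eq_norm, dist_eq_norm,
    norm_sub_sq_real, norm_sub_sq_real, norm_smul, inner_smul_left, Real.norm_of_nonneg h0]
  simp only [conj_trivial]
  ring

/-- Points on two sides of a geodesic triangle, at proportions `s` and `s'` from the common
vertex. -/
theorem IsCAT0.dist_le_of_proportions (hM : IsCAT0 M) {p q r x y : M} {s s' : ℝ}
    (h0 : 0 ≤ s) (h1 : s ≤ 1) (h0' : 0 ≤ s') (h1' : s' ≤ 1)
    (hpx : dist p x = s * dist p q) (hxq : dist x q = (1 - s) * dist p q)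
    (hpy : dist p y = s' * dist p r) (hyr : dist y r = (1 - s') * dist p r) :
    dist x y ≤ s * dist q r + |s - s'| * dist p r := by
  obtain ⟨q₀, r₀, hq, hr, hqr⟩ := exists_comparison_triangle p q r
  have hle : dist x y ≤ dist (s • q₀) (s' • r₀) := by
    refine hM.thin p q r x y 0 q₀ r₀ (s • q₀) (s' • r₀) (by rw [hpx, hxq]; ring)
      (by rw [hpy, hyr]; ring) hq hr hqr ?_ ?_ ?_ ?_
    · rw [dist_zero_smul_of_nonneg h0, hq, hpx]
    · rw [dist_smul_right_of_le_one h1, hq, hxq]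
    · rw [dist_zero_smul_of_nonneg h0', hr, hpy]
    · rw [dist_smul_right_of_le_one h1', hr, hyr]
  refine hle.trans ((dist_triangle _ (s • r₀) _).trans_eq ?_)
  rw [dist_smul₀, hqr, Real.norm_of_nonneg h0, dist_eq_norm (s • r₀), ← sub_smul, norm_smul,
    Real.norm_eq_abs, ← dist_zero_left, hr]

/-- The broken path from `q` through a point `x` of a segment `[p, z]` to `z` is almost as short as
the direct path, if `x` is far away from `p` compared to `d(p, q)`. This is uniform in `z`. -/
theorem IsCAT0.dist_add_dist_le (hM : IsCAT0 M) {p q x z : M} {η : ℝ} (hη : 0 < η)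
    (hpos : 0 < dist p x) (hx : dist p x + dist x z = dist p z) (hD : dist p q ≤ dist p x)
    (hfar : dist p q ^ 2 ≤ 2 * η * (dist p x - dist p q)) :
    dist q x + dist x z ≤ dist q z + η := by
  have hxz : 0 ≤ dist x z := dist_nonneg
  have hL : 0 < dist p z := by linarith
  have h1 := hM.sq_dist_le (p := p) (q := z) (r := q) (x := x) (s := dist p x / dist p z)
    (by positivity) ((div_le_one hL).2 (by linarith)) (by field_simp)
    (by field_simp; linarith)
  have ha := abs_dist_sub_le p q z
  rw [dist_comm x q, dist_comm z q] at h1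
  rw [abs_le] at ha
  have hq : 0 ≤ dist p q := dist_nonneg
  have hs0 : 0 ≤ dist p x / dist p z := by positivity
  have hs : dist p x / dist p z * dist p z = dist p x := by field_simp
  rw [show dist x z = dist p z - dist p x by linarith]
  generalize dist p x / dist p z = s at *
  generalize dist p x = r at *
  generalize dist p z = L at *
  generalize dist p q = D at *
  generalize dist q z = w at *
  subst hs
  have h2 : dist q x ^ 2 ≤ (s * L - (L - w) + η) ^ 2 := by
    have h3 : (1 - s) * D ^ 2 + s * w ^ 2 - s * (1 - s) * L ^ 2 =
        (s * L - (L - w)) ^ 2 + (D ^ 2 - (L - w) ^ 2) - s * (D ^ 2 - (L - w) ^ 2) := by ring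
    have h4 : 0 ≤ D ^ 2 - (L - w) ^ 2 := by nlinarith
    nlinarith [mul_nonneg hs0 h4, mul_nonneg hη.le (show 0 ≤ D - (L - w) by linarith),
      sq_nonneg (L - w), sq_nonneg η]
  have h5 := abs_le_of_sq_le_sq' h2 (by linarith)
  linarith [h5.2]

theorem exists_far_radius {η : ℝ} (hη : 0 < η) {D : ℝ} (hD : 0 ≤ D) :
    ∃ r : ℝ, 0 < r ∧ D ≤ r ∧ D ^ 2 ≤ 2 * η * (r - D) := by
  have h : 0 ≤ D ^ 2 / (2 * η) := by positivity
  refine ⟨D + D ^ 2 / (2 * η) + 1, by positivity, by linarith, ?_⟩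
  have h2 : 2 * η * (D + D ^ 2 / (2 * η) + 1 - D) = D ^ 2 + 2 * η := by
    field_simp
    ring
  rw [h2]
  linarith

end Comparison

/-! ### Rays and Busemann functions -/

section Rays

variable {M : Type*} [MetricSpace M]

theorem Ray.dist_eq (γ : Ray M) (s t : ℝ≥0) :
    dist (γ.toFun s) (γ.toFun t) = |(s : ℝ) - t| := by
  rw [γ.isometry.dist_eq]
  rfl

theorem Ray.dist_zero_left (γ : Ray M) (t : ℝ≥0) : dist (γ.toFun 0) (γ.toFun t) = t := by
  simp [γ.dist_eq]

theorem Ray.dist_of_le (γ : Ray M) {s t : ℝ≥0} (hst : s ≤ t) :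
    dist (γ.toFun s) (γ.toFun t) = t - s := by
  rw [γ.dist_eq, abs_sub_comm, abs_of_nonneg (sub_nonneg.2 (by exact_mod_cast hst))]

theorem sub_dist_le_busemann (γ : Ray M) (p : M) (t : ℝ≥0) :
    t - dist p (γ.toFun t) ≤ busemann γ p := by
  refine ge_of_tendsto (tendsto_busemann γ p) ((eventually_ge_atTop t).mono fun s hs => ?_)
  have h1 := dist_triangle p (γ.toFun t) (γ.toFun s)
  rw [γ.dist_of_le hs] at h1
  linarith

theorem IsCAT0.busemann_le (hM : IsCAT0 M) (γ : Ray M) (p : M) {η : ℝ} (hη : 0 < η) {t : ℝ≥0}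
    (ht : 0 < t) (hD : dist (γ.toFun 0) p ≤ t)
    (hfar : dist (γ.toFun 0) p ^ 2 ≤ 2 * η * (t - dist (γ.toFun 0) p)) :
    busemann γ p ≤ t - dist p (γ.toFun t) + η := by
  refine le_of_tendsto (tendsto_busemann γ p) ((eventually_ge_atTop t).mono fun s hs => ?_)
  have hx := γ.dist_zero_left t
  have h1 := hM.dist_add_dist_le (p := γ.toFun 0) (q := p) (x := γ.toFun t) (z := γ.toFun s) hη
    (by rw [hx]; exact_mod_cast ht) (by rw [hx, γ.dist_zero_left, γ.dist_of_le hs]; ring)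
    (by rwa [hx]) (by rwa [hx])
  rw [γ.dist_of_le hs] at h1
  linarith

theorem busemann_sub_dist_le (γ : Ray M) (p q : M) :
    busemann γ p - dist p q ≤ busemann γ q := by
  refine le_of_tendsto_of_tendsto' ((tendsto_busemann γ p).sub_const _) (tendsto_busemann γ q)
    fun t => ?_
  have h1 := dist_triangle q p (γ.toFun t)
  rw [dist_comm q p] at h1
  linarith

theorem busemann_map (f : M ≃ᵢ M) (γ : Ray M) (p : M) :
    busemann (Ray.map f γ) (f p) = busemann γ p := by
  refine tendsto_nhds_unique (tendsto_busemann _ _) ?_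
  simp only [Ray.map, f.isometry.dist_eq]
  exact tendsto_busemann γ p

theorem abs_mul_eq_mul_abs {a b c d : ℝ} (hb : 0 ≤ b) (hd : 0 ≤ d) (h : a * b = d * c) :
    |a| * b = d * |c| := by
  have := congrArg abs h
  rwa [abs_mul, abs_mul, abs_of_nonneg hb, abs_of_nonneg hd] at this

/-- The points at distance `r` from `p` on two geodesics from `p` whose endpoints are within
distance `K` of each other are close to each other if the endpoints are far away. -/
theorem IsCAT0.dist_le_of_same_radius (hM : IsCAT0 M) {p z z' x x' : M} {r K : ℝ} (hr : 0 ≤ r)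
    (hx : dist p x = r) (hxz : dist x z = dist p z - r) (hx' : dist p x' = r)
    (hxz' : dist x' z' = dist p z' - r) (hz : 0 < dist p z) (hz' : 0 < dist p z')
    (hK : dist z z' ≤ K) : dist x x' ≤ 2 * r * K / dist p z := by
  have h1 := dist_nonneg (x := x) (y := z)
  have h2 := dist_nonneg (x := x') (y := z')
  have h := hM.dist_le_of_proportions (p := p) (q := z) (r := z') (x := x) (y := x')
    (s := r / dist p z) (s' := r / dist p z') (by positivity)
    ((div_le_one hz).2 (by linarith)) (by positivity) ((div_le_one hz').2 (by linarith))
    (by rw [hx]; field_simp) (by rw [hxz]; field_simp) (by rw [hx']; field_simp)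
    (by rw [hxz']; field_simp)
  have h3 : |r / dist p z - r / dist p z'| * dist p z' =
      r / dist p z * |dist p z' - dist p z| :=
    abs_mul_eq_mul_abs hz'.le (by positivity) (by field_simp)
  have h4 : |dist p z' - dist p z| ≤ K := by
    rw [abs_sub_comm, dist_comm p, dist_comm p]
    exact (abs_dist_sub_le z z' p).trans hK
  have h5 : 0 ≤ r / dist p z := by positivity
  rw [h3] at h
  have h6 := mul_le_mul_of_nonneg_left hK h5
  have h7 := mul_le_mul_of_nonneg_left h4 h5
  calc dist x x' ≤ r / dist p z * K + r / dist p z * K := by linarith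
    _ = 2 * r * K / dist p z := by ring

theorem tendsto_dist_ray (γ : Ray M) (p : M) :
    Tendsto (fun t : ℝ≥0 => dist p (γ.toFun t)) atTop atTop := by
  have h : Tendsto (fun t : ℝ≥0 => (t : ℝ) + -dist p (γ.toFun 0)) atTop atTop :=
    tendsto_atTop_add_const_right _ _ (NNReal.tendsto_coe_atTop.2 tendsto_id)
  refine tendsto_atTop_mono (fun t => ?_) h
  have h1 := dist_triangle (γ.toFun 0) p (γ.toFun t)
  rw [γ.dist_zero_left, dist_comm (γ.toFun 0)] at h1
  linarith

theorem IsCAT0.busemann_sub_le_of_asymptotic (hM : IsCAT0 M) {γ γ' : Ray M}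
    (h : γ.endpoint = γ'.endpoint) (p q : M) :
    busemann γ p - busemann γ q ≤ busemann γ' p - busemann γ' q := by
  obtain ⟨K, hK⟩ : ∃ K : ℝ, ∀ t : ℝ≥0, dist (γ.toFun t) (γ'.toFun t) ≤ K := Quotient.exact h
  have hlim : ∀ γ : Ray M, Tendsto (fun t : ℝ≥0 => dist q (γ.toFun t) - dist p (γ.toFun t)) atTop
      (𝓝 (busemann γ p - busemann γ q)) := fun γ => by
    convert (tendsto_busemann γ p).sub (tendsto_busemann γ q) using 2
    ring
  refine le_of_forall_pos_le_add fun η hη => ?_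
  obtain ⟨r, hr, hD, hfar⟩ := exists_far_radius (half_pos hη) (dist_nonneg (x := p) (y := q))
  refine le_of_tendsto_of_tendsto (hlim γ) ((hlim γ').add_const η) ?_
  filter_upwards [(tendsto_dist_ray γ p).eventually_ge_atTop r,
    (tendsto_dist_ray γ' p).eventually_ge_atTop r,
    (tendsto_dist_ray γ p).eventually_ge_atTop (2 * r * K / (η / 2))] with t ht ht' htK
  obtain ⟨x, hx, hxz⟩ := hM.exists_between hr.le ht
  obtain ⟨x', hx', hxz'⟩ := hM.exists_between hr.le ht'
  have h1 := hM.dist_le_of_same_radius hr.le hx hxz hx' hxz' (hr.trans_le ht) (hr.trans_le ht')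
    (hK t)
  have h2 : 2 * r * K / dist p (γ.toFun t) ≤ η / 2 := by
    rw [div_le_iff₀ (hr.trans_le ht)]
    rw [div_le_iff₀ (half_pos hη)] at htK
    linarith
  have h3 := hM.dist_add_dist_le (p := p) (q := q) (x := x') (z := γ'.toFun t) (half_pos hη)
    (by rwa [hx']) (by rw [hx', hxz']; ring)
    (by rwa [hx']) (by rwa [hx'])
  have h4 := dist_triangle q x (γ.toFun t)
  have h5 := dist_triangle q x' x
  rw [dist_comm x' x] at h5
  linarith

/-- The Busemann functions of asymptotic rays differ by a constant. -/
theorem IsCAT0.busemann_sub_eq_of_asymptotic (hM : IsCAT0 M) {γ γ' : Ray M}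
    (h : γ.endpoint = γ'.endpoint) (p q : M) :
    busemann γ p - busemann γ q = busemann γ' p - busemann γ' q :=
  (hM.busemann_sub_le_of_asymptotic h p q).antisymm (hM.busemann_sub_le_of_asymptotic h.symm p q)

/-! ### Compactness of the space of rays from a base point -/

/-- A family of maps that are eventually isometric on each pair of parameters and start at `b`
converges pointwise to a ray along any ultrafilter. -/
theorem exists_ray_tendsto [ProperSpace M] {ι : Type*} (U : Ultrafilter ι) {σ : ι → ℝ≥0 → M}
    {b : M} (hb : ∀ᶠ i in U, σ i 0 = b)
    (hσ : ∀ s t : ℝ≥0, ∀ᶠ i in U, dist (σ i s) (σ i t) = dist s t) :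
    ∃ γ : Ray M, γ.toFun 0 = b ∧ ∀ t, Tendsto (fun i => σ i t) U (𝓝 (γ.toFun t)) := by
  have hlim : ∀ t : ℝ≥0, ∃ x, Tendsto (fun i => σ i t) U (𝓝 x) := by
    intro t
    obtain ⟨x, -, hx⟩ := (isCompact_closedBall b t).ultrafilter_le_nhds (U.map fun i => σ i t) (by
      rw [le_principal_iff, Ultrafilter.coe_map, mem_map]
      filter_upwards [hb, hσ t 0] with i h0 hi
      rw [mem_preimage, Metric.mem_closedBall, ← h0, hi]
      simp [NNReal.dist_eq])
    exact ⟨x, hx⟩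
  choose γ hγ using hlim
  refine ⟨⟨γ, Isometry.of_dist_eq fun s t => ?_⟩, ?_, hγ⟩
  · exact tendsto_nhds_unique ((hγ s).dist (hγ t))
      (tendsto_const_nhds.congr' ((hσ s t).mono fun i hi => hi.symm))
  · exact tendsto_nhds_unique (hγ 0) (tendsto_const_nhds.congr' (hb.mono fun i hi => hi.symm))

instance compactSpace_rays [ProperSpace M] (b : M) :
    CompactSpace {γ : Ray M // γ.toFun 0 = b} := by
  refine ⟨isCompact_iff_ultrafilter_le_nhds.2 fun U _ => ?_⟩
  obtain ⟨γ, hb, hγ⟩ := exists_ray_tendsto U (σ := fun γ => γ.1.toFun) (b := b)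
    (Eventually.of_forall fun γ => γ.2)
    fun s t => Eventually.of_forall fun γ => γ.1.isometry.dist_eq s t
  refine ⟨⟨γ, hb⟩, mem_univ _, ?_⟩
  change Tendsto id (U : Filter {γ : Ray M // γ.toFun 0 = b}) _
  rw [tendsto_subtype_rng, nhds_induced, tendsto_comap_iff,
    ContinuousMap.tendsto_iff_tendstoLocallyUniformly, Metric.tendstoLocallyUniformly_iff]
  intro ε hε t
  -- rays are equicontinuous, so that pointwise convergence is locally uniform
  refine ⟨Metric.ball t (ε / 3), Metric.ball_mem_nhds _ (by positivity), ?_⟩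
  filter_upwards [(hγ t).eventually (Metric.ball_mem_nhds _ (show 0 < ε / 3 by positivity))]
    with δ hδ s hs
  have h1 := dist_triangle4 (γ.toFun s) (γ.toFun t) (δ.1.toFun t) (δ.1.toFun s)
  rw [γ.isometry.dist_eq, δ.1.isometry.dist_eq, dist_comm t s] at h1
  rw [Metric.mem_ball] at hs
  rw [dist_comm] at hδ
  show dist (γ.toFun s) (δ.1.toFun s) < ε
  linarith

/-- In a proper CAT(0) space every boundary point is the endpoint of a ray from the base point: the
segments from `b` to `γ(n)` accumulate at such a ray. -/
theorem IsCAT0.exists_ray_from [ProperSpace M] (hM : IsCAT0 M) (b : M) (e : Boundary M) :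
    ∃ γ : Ray M, γ.toFun 0 = b ∧ γ.endpoint = e := by
  obtain ⟨γ, rfl⟩ := Quotient.exists_rep e
  set K := dist b (γ.toFun 0) with hK
  have hgeo := fun n : ℕ => hM.geodesic b (γ.toFun n)
  choose σ hσ0 hσ1 hσ using hgeo
  have hlen : ∀ n : ℕ, |dist b (γ.toFun n) - n| ≤ K := by
    intro n
    have := abs_dist_sub_le b (γ.toFun 0) (γ.toFun n)
    rwa [γ.dist_zero_left] at this
  have hlarge : ∀ t : ℝ≥0, ∀ᶠ n : ℕ in atTop, (t : ℝ) ≤ dist b (γ.toFun n) ∧ (t : ℝ) ≤ n ∧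
      (0 : ℝ) < n := by
    intro t
    filter_upwards [eventually_ge_atTop ⌈t + K⌉₊, eventually_gt_atTop 0] with n hn hn0
    have h1 := Nat.ceil_le.1 hn
    have h2 := (abs_le.1 (hlen n)).1
    have h3 : 0 ≤ K := dist_nonneg
    exact ⟨by linarith, by linarith, by exact_mod_cast hn0⟩
  have hU : ((hyperfilter ℕ : Ultrafilter ℕ) : Filter ℕ) ≤ atTop := Nat.hyperfilter_le_atTop
  obtain ⟨δ, hδb, hδ⟩ := exists_ray_tendsto (hyperfilter ℕ) (σ := fun n t => σ n t) (b := b)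
    (Eventually.of_forall fun n => by simpa using hσ0 n)
    fun s t => by
      filter_upwards [hU (hlarge s), hU (hlarge t)] with n hs ht
      exact hσ n s ⟨s.2, hs.1⟩ t ⟨t.2, ht.1⟩
  refine ⟨δ, hδb, Quotient.sound ⟨K + K, fun t => ?_⟩⟩
  refine le_of_tendsto ((hδ t).dist tendsto_const_nhds) ?_
  filter_upwards [hU (hlarge t), hU (hlarge 1)] with n ⟨hℓ, hn, hn0⟩ ⟨hℓ1, _⟩
  -- compare the two sides of the triangle `γ(n), γ(0), b` that meet in `γ(n)`
  have ht0 : (0 : ℝ) ≤ t := t.2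
  have hℓ0 : 0 < dist b (γ.toFun n) := by
    rw [NNReal.coe_one] at hℓ1
    linarith
  have hσt : dist b (σ n t) = t := by
    have := hσ n 0 ⟨le_rfl, hℓ0.le⟩ t ⟨ht0, hℓ⟩
    rwa [hσ0, zero_sub, abs_neg, abs_of_nonneg ht0] at this
  have hσt' : dist (γ.toFun n) (σ n t) = dist b (γ.toFun n) - t := by
    have := hσ n (dist b (γ.toFun n)) ⟨hℓ0.le, le_rfl⟩ t ⟨ht0, hℓ⟩
    rwa [hσ1, abs_of_nonneg (by linarith)] at this
  have hγt : dist (γ.toFun n) (γ.toFun t) = n - t := by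
    rw [dist_comm, γ.dist_of_le (by exact_mod_cast hn)]
    rfl
  have hγ0 : dist (γ.toFun n) (γ.toFun 0) = n := by
    rw [dist_comm, γ.dist_zero_left]
    rfl
  have h := hM.dist_le_of_proportions (p := γ.toFun n) (q := γ.toFun 0) (r := b)
    (x := γ.toFun t) (y := σ n t) (s := (n - t) / n)
    (s' := (dist b (γ.toFun n) - t) / dist b (γ.toFun n))
    (div_nonneg (by linarith) hn0.le) ((div_le_one hn0).2 (by linarith))
    (div_nonneg (by linarith) hℓ0.le) ((div_le_one hℓ0).2 (by linarith))
    (by rw [hγt, hγ0]; field_simp)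
    (by rw [dist_comm, γ.dist_zero_left, hγ0]; field_simp; ring)
    (by rw [hσt', dist_comm _ b]; field_simp)
    (by rw [dist_comm, hσt, dist_comm _ b]; field_simp; ring)
  have h1 : (n - t) / n * dist (γ.toFun 0) b ≤ K := by
    rw [dist_comm, ← hK]
    exact mul_le_of_le_one_left dist_nonneg ((div_le_one hn0).2 (by linarith))
  have h2 : |(n - t) / n - (dist b (γ.toFun n) - t) / dist b (γ.toFun n)| *
      dist (γ.toFun n) b ≤ K := by
    have h3 : |(n - t) / n - (dist b (γ.toFun n) - t) / dist b (γ.toFun n)| *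
        dist b (γ.toFun n) = t / n * |n - dist b (γ.toFun n)| :=
      abs_mul_eq_mul_abs hℓ0.le (by positivity) (by field_simp; ring)
    rw [dist_comm _ b, h3, abs_sub_comm]
    exact (mul_le_of_le_one_left (abs_nonneg _) ((div_le_one hn0).2 hn)).trans (hlen n)
  rw [dist_comm]
  linarith

theorem continuous_eval_ray (b : M) (t : ℝ≥0) :
    Continuous fun γ : {γ : Ray M // γ.toFun 0 = b} => γ.1.toFun t :=
  (ContinuousEvalConst.continuous_eval_const (F := C(ℝ≥0, M)) t).comp
    ((show Continuous fun γ : Ray M => (⟨γ.toFun, γ.isometry.continuous⟩ : C(ℝ≥0, M)) from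
      continuous_induced_dom).comp continuous_subtype_val)

/-- On the rays from `b`, the functions `γ ↦ t - d(p, γ(t))` converge uniformly to the Busemann
function at `p`, which therefore depends continuously on the ray. -/
theorem IsCAT0.continuous_busemann (hM : IsCAT0 M) (b p : M) :
    Continuous fun γ : {γ : Ray M // γ.toFun 0 = b} => busemann γ.1 p := by
  refine continuous_of_uniform_approx_of_continuous fun u hu => ?_
  obtain ⟨η, hη, hsub⟩ := Metric.mem_uniformity_dist.1 hu
  obtain ⟨r, hr, hD, hfar⟩ := exists_far_radius (half_pos hη) (dist_nonneg (x := b) (y := p))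
  lift r to ℝ≥0 using hr.le
  refine ⟨fun γ => r - dist p (γ.1.toFun r),
    continuous_const.sub (continuous_const.dist (continuous_eval_ray b r)), fun γ => hsub ?_⟩
  have h1 := sub_dist_le_busemann γ.1 p r
  have h2 := hM.busemann_le γ.1 p (half_pos hη) (by exact_mod_cast hr) (by rwa [γ.2])
    (by rwa [γ.2])
  rw [Real.dist_eq, abs_lt]
  constructor <;> linarith

end Rays


/-! ### Uniform shifts over closed sets of boundary points -/

section UniformShift

variable {G : Type*} [Group G] {X : Type*} {M : Type*} [MetricSpace M]
  {A : Type*} [AddCommGroup A]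

/-- Over a closed subset of the horospherical limit set of `ρ`, finitely many chains suffice to push
each generator by a definite amount towards each point, and this persists for all nearby actions.
If these leave the subset invariant, then translating the chains pushes the whole free module. -/
theorem exists_volley_eventually_le_guaranteedShift [ProperSpace M] (hM : IsCAT0 M)
    [DistribMulAction G A] [Finite X] {ε : FreeGModule G X →+ A}
    (hεG : ∀ (g : G) (c : FreeGModule G X), ε (translate g c) = g • ε c)
    {h : X → Finset M} (hh : ∀ x, (h x).Nonempty) {b : M} {E : Set (Boundary M)}
    (hE : IsClosed[coneTopology b] E) {ρ : G →* (M ≃ᵢ M)}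
    (hlim : E ⊆ horosphericalLimitSet ρ h ε) :
    ∃ Φ : FreeGModule G X → Set (FreeGModule G X), IsVolley Φ ∧ (∀ c, ε '' Φ c = {ε c}) ∧
      ∀ᶠ ρ' in 𝓝 ρ, ρ' ∈ actionsPreserving G E → ∀ e ∈ E,
        ∃ φ : FreeGModule G X →+ FreeGModule G X,
          IsSelection Φ φ ∧ ((1 : ℝ) : EReal) ≤ guaranteedShift ρ' h e φ := by
  let B := {γ : Ray M // γ.toFun 0 = b}
  let K : Set B := {γ | γ.1.endpoint ∈ E}
  have hK : IsCompact K := (isClosed_coinduced.1 hE).isCompact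
  -- `3` leaves room for a loss of `1` when the ray varies and of `1` when the action varies
  have hpush : ∀ γ ∈ K, ∀ x : X, ∃ c : FreeGModule G X, ε c = ε (Finsupp.single (1, x) 1) ∧
      ∀ y ∈ c.support, ∀ p ∈ h y.2, ∀ q ∈ h x,
        busemann γ.1 q + 3 ≤ busemann γ.1 (ρ y.1 p) := by
    intro γ hγ x
    obtain ⟨t, ht⟩ := ((h x).finite_toSet.image fun q => busemann γ.1 q).bddAbove
    obtain ⟨c, hc, hcγ⟩ := hlim hγ γ.1 rfl (t + 3) (ε (Finsupp.single (1, x) 1))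
    refine ⟨c, hc, fun y hy p hp q hq => ?_⟩
    have h1 : t + 3 ≤ busemann γ.1 (ρ y.1 p) := hcγ (mem_biUnion hy ⟨p, hp, rfl⟩)
    have h2 : busemann γ.1 q ≤ t := ht ⟨q, hq, rfl⟩
    linarith
  choose! c hc hcpush using hpush
  let U : B → Set B := fun δ => {γ | ∀ x : X, ∀ y ∈ (c δ x).support, ∀ p ∈ h y.2, ∀ q ∈ h x,
    busemann γ.1 q + 2 < busemann γ.1 (ρ y.1 p)}
  have hU : ∀ δ ∈ K, U δ ∈ 𝓝 δ := fun δ hδ =>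
    eventually_all.2 fun x => (Filter.eventually_all_finset _).2 fun y hy =>
      (Filter.eventually_all_finset _).2 fun p hp => (Filter.eventually_all_finset _).2 fun q hq =>
        ((hM.continuous_busemann b q).continuousAt.add continuousAt_const).eventually_lt
          (hM.continuous_busemann b _).continuousAt (by
            have := hcpush δ hδ x y hy p hp q hq
            show busemann δ.1 q + 2 < busemann δ.1 (ρ y.1 p)
            linarith)
  obtain ⟨T, hT⟩ := hK.elim_nhds_subcover' (fun δ _ => U δ) hU
  let C : X → Set (FreeGModule G X) := fun x =>
    insert (Finsupp.single (1, x) 1) ((fun δ : K => c δ.1 x) '' (T : Set K))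
  refine ⟨volleyOf C, isVolley_volleyOf fun x => (T.finite_toSet.image _).insert _,
    image_volleyOf hεG ?_ fun x => insert_nonempty _ _, ?_⟩
  · rintro x _ (rfl | ⟨δ, -, rfl⟩)
    · rfl
    · exact hc δ.1 δ.2 x
  have hS : (⋃ δ ∈ (T : Set K), ⋃ x : X, ⋃ y ∈ ((c δ.1 x).support : Set (G × X)),
      (fun p => (y.1, p)) '' (h y.2 : Set M)).Finite :=
    T.finite_toSet.biUnion fun δ _ => Set.finite_iUnion fun x =>
      (c δ.1 x).support.finite_toSet.biUnion fun y _ => (h y.2).finite_toSet.image _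
  filter_upwards [eventually_forall_dist_lt hS ρ one_pos] with ρ' hρ' hinv e he
  have hidx : ∀ e' ∈ E, ∃ δ : K, δ ∈ T ∧ ∃ γ : B, γ.1.endpoint = e' ∧ γ ∈ U δ.1 := by
    intro e' he'
    obtain ⟨γ, hγb, hγe⟩ := hM.exists_ray_from b e'
    obtain ⟨δ, hδ, hγδ⟩ := mem_iUnion₂.1 (hT (show (⟨γ, hγb⟩ : B) ∈ K by
      show γ.endpoint ∈ E
      rwa [hγe]))
    exact ⟨δ, hδ, ⟨γ, hγb⟩, hγe, hγδ⟩
  have hmap : ∀ g, Boundary.map (ρ' g) e ∈ E := fun g => hinv g ▸ mem_image_of_mem _ he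
  choose δ hδT γ hγe hγU using fun g => hidx _ (hmap g)
  refine ⟨additiveExtension fun y => translate y.1 (c (δ y.1⁻¹).1 y.2),
    isSelection_additiveExtension fun y => ⟨_, Or.inr ⟨_, hδT _, rfl⟩, rfl⟩,
    le_guaranteedShift_additiveExtension hh ?_⟩
  rintro η rfl ⟨g, x⟩ z hz p hp
  obtain ⟨y, hy, rfl⟩ := exists_of_mem_support_translate hz
  obtain ⟨q, hq⟩ := hh x
  refine ⟨q, hq, ?_⟩
  -- move the situation by `g⁻¹`, and compare the resulting ray with the asymptotic one from `b`
  have hback : ∀ q : M, busemann η (ρ' g q) = busemann (Ray.map (ρ' g⁻¹) η) q := fun q => by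
    rw [← busemann_map (ρ' g⁻¹) η, ← action_mul_apply, inv_mul_cancel, action_one_apply]
  have h1 := hM.busemann_sub_eq_of_asymptotic (hγe g⁻¹).symm (ρ' y.1 p) q
  have h2 := hγU g⁻¹ x y hy p hp q hq
  have h3 := hρ' (y.1, p) (mem_biUnion (hδT g⁻¹) (mem_iUnion.2 ⟨x, mem_biUnion hy ⟨p, hp, rfl⟩⟩))
  have h4 := busemann_sub_dist_le (γ g⁻¹).1 (ρ y.1 p) (ρ' y.1 p)
  rw [dist_comm] at h4
  rw [action_mul_apply, hback, hback]
  simp only at h3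
  linarith

/-- A selection from a volley that induces the identity of `A` realizes membership in the dynamical
limit set as soon as its guaranteed shift is bounded below by a positive number. -/
theorem mem_dynamicalLimitSet_of_isSelection {ρ : G →* (M ≃ᵢ M)} {h : X → Finset M}
    {ε : FreeGModule G X →+ A} {Φ : FreeGModule G X → Set (FreeGModule G X)} (hΦ : IsVolley Φ)
    (hΦε : ∀ c, ε '' Φ c = {ε c}) {φ : FreeGModule G X →+ FreeGModule G X} (hφ : IsSelection Φ φ)
    {e : Boundary M} {ν : ℝ} (hν : 0 < ν) (hle : (ν : EReal) ≤ guaranteedShift ρ h e φ) :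
    e ∈ dynamicalLimitSet ρ h ε := by
  refine ⟨φ, ⟨Φ, hΦ, hφ⟩, fun c => ?_, lt_of_lt_of_le (by exact_mod_cast hν) hle⟩
  have : ε (φ c) ∈ ε '' Φ c := mem_image_of_mem _ (hφ c)
  rwa [hΦε] at this

theorem Boundary.map_surjective (f : M ≃ᵢ M) : Function.Surjective (Boundary.map f) := by
  intro e
  obtain ⟨γ, rfl⟩ := Quotient.exists_rep e
  refine ⟨(Ray.map f.symm γ).endpoint, ?_⟩
  have : Ray.map f (Ray.map f.symm γ) = γ := by
    cases γ
    simp [Ray.map]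
  exact congrArg Ray.endpoint this

theorem mem_actionsPreserving_univ (ρ : G →* (M ≃ᵢ M)) :
    ρ ∈ actionsPreserving G (Set.univ : Set (Boundary M)) := fun g => by
  rw [image_univ, (Boundary.map_surjective (ρ g)).range_eq]

end UniformShift

end HoroLimit


theorem theorem6p1 {G : Type*} [Group G] {M : Type*} [MetricSpace M] [ProperSpace M]
    (hM : IsCAT0 M) {A : Type*} [AddCommGroup A] [DistribMulAction G A]
    {X : Type*} [Finite X] (ε : FreeGModule G X →+ A)
    (hεG : ∀ (g : G) (c : FreeGModule G X), ε (translate g c) = g • ε c)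
    (hε : Function.Surjective ε)
    (h : X → Finset M) (hh : ∀ x, (h x).Nonempty) (b : M) :
    (∀ E : Set (Boundary M), IsClosed[coneTopology b] E →
      ∀ ρ : actionsPreserving G E, E ⊆ horosphericalLimitSet ρ.1 h ε →
        ∃ N ∈ 𝓝 ρ,
          (∀ ρ' ∈ N, E ⊆ dynamicalLimitSet ρ'.1 h ε) ∧
          ∃ ν : ℝ, 0 < ν ∧ ∃ Φ : FreeGModule G X → Set (FreeGModule G X),
            IsVolley Φ ∧ (∀ c, ε '' Φ c = {ε c}) ∧
            ∀ e ∈ E, ∀ ρ' ∈ N, ∃ φ : FreeGModule G X →+ FreeGModule G X,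
              IsSelection Φ φ ∧ (ν : EReal) ≤ guaranteedShift ρ'.1 h e φ) ∧
    IsOpen {ρ : G →* (M ≃ᵢ M) | dynamicalLimitSet ρ h ε = Set.univ} ∧
    IsOpen {ρ : {ρ : G →* (M ≃ᵢ M) // HasDiscreteOrbits ρ} |
      IsCocompact ρ.1 ∧ FinitelyGeneratedOver (stabilizer ρ.1 b) A} := by
  refine ⟨fun E hE ρ hlim => ?_, ?_, isOpen_cocompact_finitelyGeneratedOver hM hεG hε b⟩
  · obtain ⟨Φ, hΦ, hΦε, hN⟩ := exists_volley_eventually_le_guaranteedShift hM hεG hh hE hlim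
    refine ⟨_, continuous_subtype_val.continuousAt.eventually hN, fun ρ' hρ' e he => ?_, 1, one_pos,
      Φ, hΦ, hΦε, fun e he ρ' hρ' => hρ' ρ'.2 e he⟩
    obtain ⟨φ, hφ, hle⟩ := hρ' ρ'.2 e he
    exact mem_dynamicalLimitSet_of_isSelection hΦ hΦε hφ one_pos hle
  · rw [isOpen_iff_mem_nhds]
    intro ρ hρ
    have hlim : Set.univ ⊆ horosphericalLimitSet ρ h ε :=
      hρ.ge.trans (dynamicalLimitSet_subset_horosphericalLimitSet hh hε)
    obtain ⟨Φ, hΦ, hΦε, hN⟩ := exists_volley_eventually_le_guaranteedShift hM hεG hh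
      (@isClosed_univ _ (coneTopology b)) hlim
    filter_upwards [hN] with ρ' hρ'
    refine eq_univ_of_forall fun e => ?_
    obtain ⟨φ, hφ, hle⟩ := hρ' (mem_actionsPreserving_univ ρ') e (mem_univ e)
    exact mem_dynamicalLimitSet_of_isSelection hΦ hΦε hφ one_pos hle
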